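/- There is an absolute constant $C>0$ such that for every $\epsilon\in(0,1]$ there are numbers $r(n)\in\mathbb N$ ($n\ge 1$) with $$r(n)\;\le\;2^{C\,n\log n}\,(1+1/\epsilon)^n ,$$ and a deterministic online procedure of the following kind. The points of a finite metric space are exposed one by one, each together with its distances to the previously exposed points. On the exposure of a point the procedure, which knows neither the number nor the distances of the points still to come, irrevocably assigns to it a sequence of real coordinates that depends only on the mutual distances of the points exposed so far. For every $n\ge 1$, every $n$-point metric space $(X,d)$ and every order of exposure of its points, the first $r=r(n)$ coordinates define an injective map $\phi:X\to\ell_\infty^{r}=(\mathbb R^r,\|\cdot\|_\infty)$ whose multiplicative distortion $$\max_{u\ne v}\frac{\|\phi(u)-\phi(v)\|_\infty}{d(u,v)}\;\cdot\;\max_{u\ne v}\frac{d(u,v)}{\|\phi(u)-\phi(v)\|_\infty}$$ is at most $1+\epsilon$ (for $n=1$ this condition is void). In particular, for each fixed $n$ the $n$-point metric spaces can be deterministically online embedded into $\ell_\infty^{r(n)}$ with distortion at most $1+\epsilon$. -/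

import Mathlib

open scoped ENNReal

/-- The expansion `max_{u ≠ v} d(φ u, φ v) / d(u, v)` of a map between metric spaces. -/
noncomputable def expansion {X H : Type*} [MetricSpace X] [MetricSpace H] (φ : X → H) : ℝ≥0∞ :=
  ⨆ (u : X) (v : X) (_ : u ≠ v), edist (φ u) (φ v) / edist u v

/-- The contraction `max_{u ≠ v} d(u, v) / d(φ u, φ v)` of a map between metric spaces
(it is `∞` as soon as two distinct points have the same image). -/
noncomputable def contraction {X H : Type*} [MetricSpace X] [MetricSpace H] (φ : X → H) : ℝ≥0∞ :=
  ⨆ (u : X) (v : X) (_ : u ≠ v), edist u v / edist (φ u) (φ v)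

/-- The multiplicative distortion: expansion times contraction. It is meant for injective maps only
(a constant map would get the meaningless value `0 * ∞ = 0`). -/
noncomputable def distortion {X H : Type*} [MetricSpace X] [MetricSpace H] (φ : X → H) : ℝ≥0∞ :=
  expansion φ * contraction φ

/-- A deterministic online procedure with values in `H`. When the point number `t` (counted from
`0`) is exposed, the procedure sees the mutual distances of the `t + 1` points exposed so far, in
their order of exposure, and assigns a value in `H` to the new point. It sees neither the number
nor the distances of the points that are still to come, and assigned values are never changed.
(Earlier values are functions of the earlier distances, so they need not be listed as inputs.) -/
def OnlineProcedure (H : Type*) : Type _ :=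
  (t : ℕ) → (Fin (t + 1) → Fin (t + 1) → ℝ) → H

/-- The map `X → H` that the procedure `A` produces when the points of the `n`-point metric space
`X` are exposed in the order `e 0, e 1, …, e (n - 1)`. -/
def OnlineProcedure.run {H : Type*} (A : OnlineProcedure H) {X : Type*} [MetricSpace X] {n : ℕ}
    (e : Fin n ≃ X) (p : X) : H :=
  A (e.symm p) fun j k =>
    dist (e (Fin.castLE (e.symm p).isLt j)) (e (Fin.castLE (e.symm p).isLt k))

/-! The admissible values of a 1-Lipschitz extension to a new point form an interval, and each
coordinate follows a fixed rule for picking a grid point in it, so every coordinate is 1-Lipschitz.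
All choice sequences occur among the coordinates, so a pair `i < j` can use one that imitates the
target `(1 - ε/4) * dist (x i) ·`. The tracking error is itself a Lipschitz function: it extends to
the new point with the same constant (McShane), the slack `ε/4` keeps the corrected target
admissible, and rounding to the grid adds only `2 / m t` to the constant
(`exists_greedyCoord_sub_lipschitz`). With grids of size about `t^2/ε` these increments sum to at
most `ε/4`, so the pair keeps a fraction `1 - ε/2` of its distance. Mixed radix digits list the
choice sequences compatibly for all `n` (`exists_mixedDigit_eq`). -/

/-- The greedy online real coordinate: the value at `t` divides the interval of all admissible
`1`-Lipschitz extensions in the ratio `a t / m t`. -/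
noncomputable def greedyCoord (m a : ℕ → ℕ) (D : ℕ → ℕ → ℝ) (t : ℕ) : ℝ :=
  (⨆ i : Fin t, (greedyCoord m a D i - D i t)) +
    (a t : ℝ) / m t * ((⨅ i : Fin t, (greedyCoord m a D i + D i t)) -
      ⨆ i : Fin t, (greedyCoord m a D i - D i t))
termination_by t
decreasing_by all_goals exact i.isLt

theorem greedyCoord_congr {m a a' : ℕ → ℕ} {D D' : ℕ → ℕ → ℝ} (t : ℕ)
    (ha : ∀ s ≤ t, a s = a' s) (hD : ∀ i ≤ t, ∀ j ≤ t, D i j = D' i j) :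
    greedyCoord m a D t = greedyCoord m a' D' t := by
  induction t using Nat.strong_induction_on with
  | _ t ih =>
    have h : ∀ i : Fin t, greedyCoord m a D i = greedyCoord m a' D' i := fun i =>
      ih i i.isLt (fun s hs => ha s (hs.trans i.isLt.le))
        (fun k hk j hj => hD k (hk.trans i.isLt.le) j (hj.trans i.isLt.le))
    have h' : ∀ i : Fin t, D i t = D' i t := fun i => hD i i.isLt.le t le_rfl
    rw [greedyCoord, greedyCoord, ha t le_rfl]
    simp only [h, h']

/-! ### One-point Lipschitz extension and rounding. -/

theorem iSup_sub_le_iInf_add {t : ℕ} (v w : Fin t → ℝ) (h : ∀ i j, |v i - v j| ≤ w i + w j) :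
    ⨆ i, (v i - w i) ≤ ⨅ i, (v i + w i) := by
  rcases isEmpty_or_nonempty (Fin t) with _ | _
  · simp
  · exact ciSup_le fun i => le_ciInf fun j => by linarith [(abs_le.1 (h i j)).2]

theorem abs_sub_le_of_mem_extension_interval {t : ℕ} {v w : Fin t → ℝ} {c : ℝ}
    (h₁ : ⨆ i, (v i - w i) ≤ c) (h₂ : c ≤ ⨅ i, (v i + w i)) (i : Fin t) : |v i - c| ≤ w i := by
  have h₃ := le_ciSup (Set.finite_range fun i => v i - w i).bddAbove i
  have h₄ := ciInf_le (Set.finite_range fun i => v i + w i).bddBelow i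
  exact abs_le.2 ⟨by linarith, by linarith⟩

theorem mem_extension_interval {t : ℕ} [Nonempty (Fin t)] {v w : Fin t → ℝ} {c : ℝ}
    (h : ∀ i, |v i - c| ≤ w i) : ⨆ i, (v i - w i) ≤ c ∧ c ≤ ⨅ i, (v i + w i) :=
  ⟨ciSup_le fun i => by linarith [(abs_le.1 (h i)).2],
    le_ciInf fun i => by linarith [(abs_le.1 (h i)).1]⟩

/-- A point of `[L, U]` is within `(U - L) / m` of one of the points dividing `[L, U]` into `m`
equal parts. -/
theorem exists_grid_point {L U c : ℝ} (hL : L ≤ c) (hU : c ≤ U) {m : ℕ} (hm : 0 < m) :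
    ∃ b ≤ m, |L + (b : ℝ) / m * (U - L) - c| ≤ (U - L) / m := by
  have hm' : (0 : ℝ) < m := by exact_mod_cast hm
  rcases (hL.trans hU).eq_or_lt with h | h
  · exact ⟨0, hm.le, by subst h; simp [le_antisymm hL hU]⟩
  · have hd : 0 < U - L := sub_pos.2 h
    have hq : 0 ≤ (c - L) / (U - L) * m := by
      have := sub_nonneg.2 hL
      positivity
    refine ⟨⌊(c - L) / (U - L) * m⌋₊, ?_, ?_⟩
    · refine Nat.floor_le_of_le ?_
      have : (c - L) / (U - L) ≤ 1 := (div_le_one hd).2 (by linarith)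
      nlinarith
    · set b : ℝ := (⌊(c - L) / (U - L) * m⌋₊ : ℝ)
      have h₁ : b ≤ (c - L) / (U - L) * m := Nat.floor_le hq
      have h₂ : (c - L) / (U - L) * m < b + 1 := Nat.lt_floor_add_one _
      have h₃ : L + b / m * (U - L) - c =
          (b - (c - L) / (U - L) * m) * ((U - L) / m) := by
        field_simp
        ring
      have h₄ : 0 < (U - L) / m := by positivity
      rw [h₃, abs_mul, abs_of_pos h₄]
      exact mul_le_of_le_one_left h₄.le (abs_le.2 ⟨by linarith, by linarith⟩)

/-! ### Greedy coordinates on a sequence of points, possibly with repetitions. -/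

section Metric

variable {X : Type*} [PseudoMetricSpace X] (x : ℕ → X)

theorem greedyCoord_lipschitz_of_lt {m a : ℕ → ℕ} (ha : ∀ t, a t ≤ m t) (t : ℕ) :
    ∀ i < t, |greedyCoord m a (fun i j => dist (x i) (x j)) i -
      greedyCoord m a (fun i j => dist (x i) (x j)) t| ≤ dist (x i) (x t) := by
  induction t using Nat.strong_induction_on with
  | _ t ih =>
    set F := greedyCoord m a (fun i j => dist (x i) (x j)) with hF
    have hp : ∀ i < t, ∀ j < t, |F i - F j| ≤ dist (x i) (x j) := fun i hi j hj => by
      rcases lt_trichotomy i j with h | h | h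
      · exact ih j hj i h
      · simp [h]
      · rw [abs_sub_comm, dist_comm]
        exact ih i hi j h
    have hLU := iSup_sub_le_iInf_add (fun i : Fin t => F i) (fun i => dist (x i) (x t))
      fun i j => (hp i i.isLt j j.isLt).trans (dist_triangle_right _ _ _)
    have hq : (a t : ℝ) / m t ≤ 1 := div_le_one_of_le₀ (by exact_mod_cast ha t) (by positivity)
    have hq' : (0 : ℝ) ≤ (a t : ℝ) / m t := by positivity
    have ht : F t = _ := greedyCoord.eq_1 m a (fun i j => dist (x i) (x j)) t
    rw [← hF] at ht
    intro i hi
    refine abs_sub_le_of_mem_extension_interval (v := fun i : Fin t => F i)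
      (w := fun i => dist (x i) (x t)) ?_ ?_ ⟨i, hi⟩ <;> rw [ht] <;> nlinarith

theorem greedyCoord_lipschitz {m a : ℕ → ℕ} (ha : ∀ t, a t ≤ m t) (i j : ℕ) :
    |greedyCoord m a (fun i j => dist (x i) (x j)) i -
      greedyCoord m a (fun i j => dist (x i) (x j)) j| ≤ dist (x i) (x j) := by
  rcases lt_trichotomy i j with h | h | h
  · exact greedyCoord_lipschitz_of_lt x ha j i h
  · simp [h]
  · rw [abs_sub_comm, dist_comm]
    exact greedyCoord_lipschitz_of_lt x ha i j h

/-- Every `(1 - δ)`-Lipschitz function is tracked, up to an error with Lipschitz constant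
`e n ≤ δ` on the first `n` points, by a greedy coordinate. -/
theorem exists_greedyCoord_sub_lipschitz {m : ℕ → ℕ} {e : ℕ → ℝ} {δ : ℝ}
    (hm : ∀ n, 1 ≤ n → 0 < m n) (he : ∀ n, 1 ≤ n → e n + 2 / m n ≤ e (n + 1))
    (he₀ : ∀ n, 1 ≤ n → 0 ≤ e n) (heδ : ∀ n, e n ≤ δ) {g : ℕ → ℝ}
    (hg : ∀ i j, |g i - g j| ≤ (1 - δ) * dist (x i) (x j)) (n : ℕ) :
    ∃ a : ℕ → ℕ, (∀ t, a t ≤ m t) ∧ ∀ j < n, ∀ i < j,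
      |(greedyCoord m a (fun i j => dist (x i) (x j)) i - g i) -
        (greedyCoord m a (fun i j => dist (x i) (x j)) j - g j)| ≤ e n * dist (x i) (x j) := by
  induction n with
  | zero => exact ⟨0, by simp, by simp⟩
  | succ n ih =>
    obtain ⟨a, ha, h⟩ := ih
    rcases Nat.eq_zero_or_pos n with rfl | hn
    · exact ⟨a, ha, fun j hj i hi => by omega⟩
    have : Nonempty (Fin n) := ⟨⟨0, hn⟩⟩
    set F := greedyCoord m a (fun i j => dist (x i) (x j)) with hF
    have hmn : (0 : ℝ) < m n := by exact_mod_cast hm n hn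
    have hmono : e n ≤ e (n + 1) := by
      have := he n hn
      have : (0 : ℝ) ≤ 2 / m n := by positivity
      linarith
    have hp : ∀ i < n, ∀ j < n, |(F i - g i) - (F j - g j)| ≤ e n * dist (x i) (x j) := by
      intro i hi j hj
      rcases lt_trichotomy i j with hij | hij | hij
      · exact h j hj i hij
      · simp [hij]
      · rw [abs_sub_comm, dist_comm]
        exact h i hi j hij
    -- McShane extension of the error `F - g` to the new point, with value `c` and unchanged
    -- constant `e n`.
    have hc := abs_sub_le_of_mem_extension_interval (v := fun i : Fin n => F i - g i)
      (w := fun i => e n * dist (x i) (x n)) le_rfl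
      (iSup_sub_le_iInf_add (fun i : Fin n => F i - g i) (fun i => e n * dist (x i) (x n))
        fun i j => (hp i i.isLt j j.isLt).trans (by
          rw [← mul_add]
          exact mul_le_mul_of_nonneg_left (dist_triangle_right _ _ _) (he₀ n hn)))
    generalize (⨆ i : Fin n, (F i - g i - e n * dist (x i) (x n))) = c at hc
    -- The constants add up to `(1 - δ) + e n ≤ 1`, so `g n + c` is admissible.
    have hFc : ∀ i : Fin n, |F i - (g n + c)| ≤ dist (x i) (x n) := fun i => by
      have h₁ := abs_le.1 (hc i)
      have h₂ := abs_le.1 (hg i n)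
      have h₃ : e n * dist (x i) (x n) ≤ δ * dist (x i) (x n) :=
        mul_le_mul_of_nonneg_right (heδ n) dist_nonneg
      exact abs_le.2 ⟨by linarith, by linarith⟩
    obtain ⟨hL, hU⟩ := mem_extension_interval hFc
    obtain ⟨b, hb, hbc⟩ := exists_grid_point hL hU (hm n hn)
    refine ⟨Function.update a n b, fun t => ?_, ?_⟩
    · rcases eq_or_ne t n with rfl | ht
      · simpa using hb
      · simpa [ht] using ha t
    have hold : ∀ i < n, greedyCoord m (Function.update a n b) (fun i j => dist (x i) (x j)) i
        = F i := fun i hi => greedyCoord_congr i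
      (fun s hs => Function.update_of_ne (by omega) _ _) (fun _ _ _ _ => rfl)
    have hnew : |greedyCoord m (Function.update a n b) (fun i j => dist (x i) (x j)) n - (g n + c)|
        ≤ ((⨅ i : Fin n, (F i + dist (x i) (x n))) - ⨆ i : Fin n, (F i - dist (x i) (x n))) /
          m n := by
      rw [greedyCoord]
      simp only [hold _ (Fin.isLt _), Function.update_self]
      exact hbc
    intro j hj i hi
    rcases (Nat.lt_succ_iff.1 hj).lt_or_eq with hj | rfl
    · rw [hold i (hi.trans hj), hold j hj]
      exact (h j hj i hi).trans (mul_le_mul_of_nonneg_right hmono dist_nonneg)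
    · rw [hold i hi]
      have h₁ := ciInf_le (Set.finite_range fun i : Fin j => F i + dist (x i) (x j)).bddBelow
        ⟨i, hi⟩
      have h₂ := le_ciSup (Set.finite_range fun i : Fin j => F i - dist (x i) (x j)).bddAbove
        ⟨i, hi⟩
      -- The interval is no longer than twice the distance to any earlier point, so the rounding
      -- error is small relative to all these distances at once.
      have h₃ : ((⨅ i : Fin j, (F i + dist (x i) (x j))) - ⨆ i : Fin j, (F i - dist (x i) (x j))) /
          m j ≤ 2 / m j * dist (x i) (x j) := by
        rw [div_mul_eq_mul_div]
        refine div_le_div_of_nonneg_right ?_ hmn.le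
        dsimp only at h₁ h₂
        linarith
      have h₄ := abs_le.1 (hnew.trans h₃)
      have h₅ := abs_le.1 (hc ⟨i, hi⟩)
      have h₆ := mul_le_mul_of_nonneg_right (he j hn) (dist_nonneg (x := x i) (y := x j))
      dsimp only at h₅
      rw [add_mul] at h₆
      exact abs_le.2 ⟨by linarith, by linarith⟩

end Metric

/-! ### Enumeration of the choice sequences and their number. -/

/-- The digit number `t` of `k` in the mixed radix system with radices `M 0, M 1, …`. -/
def mixedDigit (M : ℕ → ℕ) (k t : ℕ) : ℕ :=
  k / (∏ s ∈ Finset.range t, M s) % M t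

theorem exists_mixedDigit_eq {M a : ℕ → ℕ} (ha : ∀ t, a t < M t) (n : ℕ) :
    ∃ k < ∏ s ∈ Finset.range n, M s, ∀ t < n, mixedDigit M k t = a t := by
  induction n with
  | zero => exact ⟨0, by simp, by simp⟩
  | succ n ih =>
    obtain ⟨k, hk, h⟩ := ih
    -- The new digit is the most significant one, so the earlier digits survive.
    refine ⟨k + (∏ s ∈ Finset.range n, M s) * a n, ?_, fun t ht => ?_⟩
    · rw [Finset.prod_range_succ]
      calc k + (∏ s ∈ Finset.range n, M s) * a n
          < (∏ s ∈ Finset.range n, M s) * (a n + 1) := by rw [mul_add_one]; omega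
        _ ≤ _ := Nat.mul_le_mul_left _ (ha n)
    · have hpos : ∀ t, 0 < ∏ s ∈ Finset.range t, M s := fun t =>
        Finset.prod_pos fun s _ => (Nat.zero_le _).trans_lt (ha s)
      rcases (Nat.lt_succ_iff.1 ht).lt_or_eq with ht | rfl
      · have hd : (∏ s ∈ Finset.range (t + 1), M s) ∣ ∏ s ∈ Finset.range n, M s :=
          Finset.prod_dvd_prod_of_subset _ _ _ (Finset.range_subset_range.2 ht)
        obtain ⟨q, hq⟩ := hd
        rw [← h t ht, mixedDigit, mixedDigit, hq, Finset.prod_range_succ, mul_assoc, mul_assoc,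
          Nat.add_mul_div_left _ _ (hpos t), Nat.add_mul_mod_self_left]
      · rw [mixedDigit, Nat.add_mul_div_left _ _ (hpos t), Nat.div_eq_of_lt hk, zero_add,
          Nat.mod_eq_of_lt (ha t)]

/-- The number of parts into which the admissible interval of the point number `t` is divided. -/
noncomputable def gridSize (ε : ℝ) (t : ℕ) : ℕ := ⌈8 * (t * (t + 1)) / ε⌉₊

/-- The number of coordinates used for `n`-point spaces. -/
noncomputable def coordCount (ε : ℝ) (n : ℕ) : ℕ := ∏ t ∈ Finset.range n, (gridSize ε t + 1)

/-- For `n ≥ 2` each factor is at most `16 n^2 (1 + 1/ε) ≤ n^6 (1 + 1/ε)`, whence the 6. For `n = 1`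
the only factor is 1, since `gridSize ε 0 = 0`. -/
theorem coordCount_le {ε : ℝ} (hε : 0 < ε) (n : ℕ) (hn : 1 ≤ n) :
    (coordCount ε n : ℝ) ≤
      (2 : ℝ) ^ (6 / Real.log 2 * ((n : ℝ) * Real.log (n : ℝ))) * (1 + 1 / ε) ^ n := by
  have hn' : (0 : ℝ) < n := by exact_mod_cast hn
  have hpow : (2 : ℝ) ^ (6 / Real.log 2 * ((n : ℝ) * Real.log (n : ℝ))) = ((n : ℝ) ^ 6) ^ n := by
    rw [Real.rpow_def_of_pos two_pos, ← pow_mul, ← Real.exp_log (pow_pos hn' (6 * n)),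
      Real.log_pow]
    congr 1
    have := (Real.log_pos one_lt_two).ne'
    field_simp
    push_cast
    ring
  rw [hpow, ← mul_pow, coordCount]
  push_cast
  rw [← Finset.card_range n, ← Finset.prod_const, Finset.card_range]
  refine Finset.prod_le_prod (fun t _ => by positivity) fun t ht => ?_
  have ht : t + 1 ≤ n := Finset.mem_range.1 ht
  have hε' : 0 < 1 / ε := by positivity
  rcases hn.eq_or_lt with rfl | h2
  · obtain rfl : t = 0 := by omega
    simp [gridSize, hε.le]
  · have h2 : (2 : ℝ) ≤ n := by exact_mod_cast h2
    have ht' : (t : ℝ) + 1 ≤ n := by exact_mod_cast ht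
    have ht₀ : (0 : ℝ) ≤ t := t.cast_nonneg
    have hc : (gridSize ε t : ℝ) < 8 * (t * (t + 1)) / ε + 1 := Nat.ceil_lt_add_one (by positivity)
    have h₁ : 8 * ((t : ℝ) * (t + 1)) / ε ≤ 8 * n ^ 2 * (1 / ε) := by
      rw [mul_one_div]
      gcongr
      nlinarith
    have h₂ : (16 : ℝ) ≤ n ^ 4 := by
      calc (16 : ℝ) = 2 ^ 4 := by norm_num
        _ ≤ _ := by gcongr
    have h₃ : 16 * (n : ℝ) ^ 2 ≤ n ^ 6 := by
      calc 16 * (n : ℝ) ^ 2 ≤ n ^ 4 * n ^ 2 := by gcongr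
        _ = _ := by ring
    have h₄ : 16 * (n : ℝ) ^ 2 * (1 + 1 / ε) ≤ n ^ 6 * (1 + 1 / ε) := by gcongr
    have h₅ : 0 ≤ (n : ℝ) ^ 2 * (1 / ε) := by positivity
    nlinarith

/-- The grid size makes `2 / gridSize ε n` at most `ε/4 * (1/n - 1/(n+1))`, which telescopes. -/
theorem error_budget {ε : ℝ} (hε : 0 < ε) (n : ℕ) (hn : 1 ≤ n) :
    0 < gridSize ε n ∧
      ε / 4 * (1 - 1 / n) + 2 / gridSize ε n ≤ ε / 4 * (1 - 1 / (n + 1 : ℕ)) := by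
  have hn' : (0 : ℝ) < n := by exact_mod_cast hn
  have hpos : 0 < 8 * ((n : ℝ) * (n + 1)) / ε := by positivity
  have hle : 8 * ((n : ℝ) * (n + 1)) / ε ≤ gridSize ε n := Nat.le_ceil _
  refine ⟨Nat.ceil_pos.2 hpos, ?_⟩
  have h : 2 / (gridSize ε n : ℝ) ≤ 2 / (8 * ((n : ℝ) * (n + 1)) / ε) := by gcongr
  have h' : ε / 4 * (1 - 1 / n) + 2 / (8 * ((n : ℝ) * (n + 1)) / ε) =
      ε / 4 * (1 - 1 / (n + 1 : ℕ)) := by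
    push_cast
    field_simp
    ring
  linarith

/-! ### The online procedure and its distortion. -/

/-- The coordinate number `k` uses the mixed radix digits of `k` as its choices. -/
noncomputable def mixedCoord (ε : ℝ) (k : ℕ) (D : ℕ → ℕ → ℝ) (t : ℕ) : ℝ :=
  greedyCoord (gridSize ε) (mixedDigit (fun s => gridSize ε s + 1) k) D t

/-- The online procedure whose coordinate number `k` is `mixedCoord ε k`. -/
noncomputable def greedyProcedure (ε : ℝ) : OnlineProcedure (ℕ → ℝ) := fun t D k =>
  mixedCoord ε k
    (fun i j => if h : i < t + 1 ∧ j < t + 1 then D ⟨i, h.1⟩ ⟨j, h.2⟩ else 0) t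

theorem greedyProcedure_run {X : Type*} [MetricSpace X] {n : ℕ} (ε : ℝ) (e : Fin n ≃ X)
    {x : ℕ → X} (hx : ∀ i : Fin n, x i = e i) (p : X) (k : ℕ) :
    (greedyProcedure ε).run e p k = mixedCoord ε k (fun i j => dist (x i) (x j)) (e.symm p) := by
  refine greedyCoord_congr _ (fun _ _ => rfl) fun i hi j hj => ?_
  have hlt := (e.symm p).isLt
  rw [dif_pos ⟨Nat.lt_succ_iff.2 hi, Nat.lt_succ_iff.2 hj⟩]
  rw [show x i = _ from hx ⟨i, by omega⟩, show x j = _ from hx ⟨j, by omega⟩]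
  rfl

theorem mixedCoord_lipschitz {X : Type*} [PseudoMetricSpace X] (x : ℕ → X) (ε : ℝ) (k i j : ℕ) :
    dist (mixedCoord ε k (fun i j => dist (x i) (x j)) i)
      (mixedCoord ε k (fun i j => dist (x i) (x j)) j) ≤ dist (x i) (x j) :=
  greedyCoord_lipschitz x (fun _ => Nat.lt_succ_iff.1 (Nat.mod_lt _ (Nat.succ_pos _))) i j

theorem exists_mixedCoord_dist_le {X : Type*} [PseudoMetricSpace X] (x : ℕ → X) {ε : ℝ}
    (hε : 0 < ε) (hε₁ : ε ≤ 1) {n i j : ℕ} (hij : i < j) (hj : j < n) :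
    ∃ k < coordCount ε n, dist (x i) (x j) ≤
      (1 + ε) * dist (mixedCoord ε k (fun i j => dist (x i) (x j)) i)
        (mixedCoord ε k (fun i j => dist (x i) (x j)) j) := by
  obtain ⟨a, ha, h⟩ := exists_greedyCoord_sub_lipschitz x (m := gridSize ε)
    (e := fun n => ε / 4 * (1 - 1 / n)) (δ := ε / 4) (fun n hn => (error_budget hε n hn).1)
    (fun n hn => (error_budget hε n hn).2)
    (fun n hn => by
      have : (1 : ℝ) / n ≤ 1 := div_le_one_of_le₀ (by exact_mod_cast hn) (by positivity)
      exact mul_nonneg (by positivity) (by linarith))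
    (fun n => by
      have : (0 : ℝ) ≤ 1 / n := by positivity
      exact mul_le_of_le_one_right (by positivity) (by linarith))
    (g := fun i => (1 - ε / 4) * dist (x i) (x j))
    (fun i k => by
      rw [← mul_sub, abs_mul, abs_of_nonneg (by linarith : 0 ≤ 1 - ε / 4)]
      exact mul_le_mul_of_nonneg_left (abs_dist_sub_le _ _ _) (by linarith)) n
  obtain ⟨k, hk, hd⟩ := exists_mixedDigit_eq (M := fun s => gridSize ε s + 1)
    (fun t => Nat.lt_succ_iff.2 (ha t)) n
  refine ⟨k, hk, ?_⟩
  have hF : ∀ t < n, mixedCoord ε k (fun i j => dist (x i) (x j)) t =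
      greedyCoord (gridSize ε) a (fun i j => dist (x i) (x j)) t := fun t ht =>
    greedyCoord_congr t (fun s hs => hd s (by omega)) (fun _ _ _ _ => rfl)
  rw [hF i (hij.trans hj), hF j hj, Real.dist_eq]
  have h₁ := (abs_le.1 (h j hj i hij)).1
  have h₂ : ε / 4 * (1 - 1 / (n : ℝ)) * dist (x i) (x j) ≤ ε / 4 * dist (x i) (x j) := by
    refine mul_le_mul_of_nonneg_right ?_ dist_nonneg
    have : (0 : ℝ) ≤ 1 / n := by positivity
    exact mul_le_of_le_one_right (by positivity) (by linarith)
  rw [dist_self] at h₁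
  have h₃ := le_abs_self (greedyCoord (gridSize ε) a (fun i j => dist (x i) (x j)) i -
    greedyCoord (gridSize ε) a (fun i j => dist (x i) (x j)) j)
  have h₄ : (1 - ε / 2) * dist (x i) (x j) ≤
      |greedyCoord (gridSize ε) a (fun i j => dist (x i) (x j)) i -
        greedyCoord (gridSize ε) a (fun i j => dist (x i) (x j)) j| := by linarith
  have h₅ : 1 ≤ (1 + ε) * (1 - ε / 2) := by nlinarith
  calc dist (x i) (x j) ≤ (1 + ε) * (1 - ε / 2) * dist (x i) (x j) :=
        le_mul_of_one_le_left dist_nonneg h₅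
    _ ≤ _ := by
        rw [mul_assoc]
        exact mul_le_mul_of_nonneg_left h₄ (by linarith)

theorem distortion_le_of_forall {X H : Type*} [MetricSpace X] [MetricSpace H] {φ : X → H} {c : ℝ}
    (h₁ : ∀ u v, dist (φ u) (φ v) ≤ dist u v) (hc : 0 ≤ c)
    (h₂ : ∀ u v, dist u v ≤ c * dist (φ u) (φ v)) : distortion φ ≤ ENNReal.ofReal c := by
  rw [← one_mul (ENNReal.ofReal c)]
  refine mul_le_mul' (iSup_le fun u => iSup_le fun v => iSup_le fun _ => ?_)
    (iSup_le fun u => iSup_le fun v => iSup_le fun _ => ?_)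
  · refine ENNReal.div_le_of_le_mul ?_
    rw [one_mul, edist_dist, edist_dist]
    exact ENNReal.ofReal_le_ofReal (h₁ u v)
  · refine ENNReal.div_le_of_le_mul ?_
    rw [edist_dist, edist_dist, ← ENNReal.ofReal_mul hc]
    exact ENNReal.ofReal_le_ofReal (h₂ u v)

/-- `C` is the constant of the `O(·)`. For each `ε` there is one online procedure, not depending on
`n`, which assigns a sequence of coordinates to every exposed point; on `n`-point spaces its first
`r n` coordinates form an embedding into `Fin (r n) → ℝ` (with the sup metric, so `ℓ_∞^{r n}`). -/
theorem mainTheorem1 :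
    ∃ C : ℝ, 0 < C ∧ ∀ ε : ℝ, 0 < ε → ε ≤ 1 →
      ∃ r : ℕ → ℕ,
        (∀ n : ℕ, 1 ≤ n →
          (r n : ℝ) ≤ (2 : ℝ) ^ (C * ((n : ℝ) * Real.log (n : ℝ))) * (1 + 1 / ε) ^ n) ∧
        ∃ A : OnlineProcedure (ℕ → ℝ),
          ∀ (n : ℕ), 1 ≤ n → ∀ (X : Type*) [MetricSpace X] (e : Fin n ≃ X),
            Function.Injective (fun (p : X) (k : Fin (r n)) => A.run e p (k : ℕ)) ∧
            distortion (fun (p : X) (k : Fin (r n)) => A.run e p (k : ℕ)) ≤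
              ENNReal.ofReal (1 + ε) := by
  refine ⟨6 / Real.log 2, div_pos (by norm_num) (Real.log_pos one_lt_two),
    fun ε hε hε₁ => ⟨coordCount ε, coordCount_le hε, greedyProcedure ε, ?_⟩⟩
  intro n hn X _ e
  set φ : X → Fin (coordCount ε n) → ℝ := fun p k => (greedyProcedure ε).run e p (k : ℕ) with hφ
  -- Padding by the first point is harmless: a coordinate at time `t` reads only distances among
  -- times up to `t`.
  let x : ℕ → X := fun i => if h : i < n then e ⟨i, h⟩ else e ⟨0, hn⟩
  have hx : ∀ i : Fin n, x i = e i := fun i => dif_pos i.isLt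
  have hxs : ∀ p, x (e.symm p) = p := fun p => by rw [hx, e.apply_symm_apply]
  have hrun : ∀ p k, φ p k =
      mixedCoord ε k (fun i j => dist (x i) (x j)) (e.symm p) :=
    fun p k => greedyProcedure_run ε e hx p k
  have h₁ : ∀ u v, dist (φ u) (φ v) ≤ dist u v := fun u v =>
    (dist_pi_le_iff dist_nonneg).2 fun k => by
      have := mixedCoord_lipschitz x ε k (e.symm u) (e.symm v)
      rwa [hxs, hxs, ← hrun, ← hrun] at this
  have hlt : ∀ u v, (e.symm u : ℕ) < e.symm v → dist u v ≤ (1 + ε) * dist (φ u) (φ v) := by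
    intro u v huv
    obtain ⟨k, hk, h⟩ := exists_mixedCoord_dist_le x hε hε₁ huv (e.symm v).isLt
    rw [hxs, hxs, ← hrun u ⟨k, hk⟩, ← hrun v ⟨k, hk⟩] at h
    exact h.trans (mul_le_mul_of_nonneg_left (dist_le_pi_dist _ _ _) (by linarith))
  have h₂ : ∀ u v, dist u v ≤ (1 + ε) * dist (φ u) (φ v) := by
    intro u v
    rcases lt_trichotomy (e.symm u : ℕ) (e.symm v) with h | h | h
    · exact hlt u v h
    · rw [e.symm.injective (Fin.ext h)]
      simp
    · rw [dist_comm u, dist_comm (φ u)]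
      exact hlt v u h
  refine ⟨fun u v huv => ?_, distortion_le_of_forall h₁ (by linarith) h₂⟩
  have h := h₂ u v
  rw [show φ u = φ v from huv, dist_self, mul_zero] at h
  exact dist_le_zero.1 h
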